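/- Let $X_1,X_2,\dots$ be a strictly stationary sequence of real random variables on a probability space, with partial maxima $M_n=\max_{1\le j\le n}X_j$ and marginal distribution function $F(x)=P(X_1\le x)$. Let $F_*=\sup\{x: F(x)<1\}\in(-\infty,+\infty]$ be the right end of $F$ and let $\Delta F(x)=F(x)-F(x-)$. For integers $r\ge 0$ let $$\alpha(r)=\sup \tfrac14\left|\mathrm{Cov}\big(f(X_{i_1},\dots,X_{i_s}),\,g(X_{j_1},\dots,X_{j_t})\big)\right|,$$ where the supremum is taken over all $s,t\ge 1$, all non-constant measurable $f:\mathbb R^s\to[-1,1]$, $g:\mathbb R^t\to[-1,1]$ and all indices $i_1\le\dots\le i_s\le j_1\le\dots\le j_t$ with $j_1-i_s\ge r$. The sequence is $\alpha$-mixing if $\alpha(r)\to0$ as $r\to\infty$. It admits a continuous phantom distribution function if there is a continuous probability distribution function $G$ on $\mathbb R$ such that $P(M_n\le u_n)-G(u_n)^n\to0$ as $n\to\infty$ for every real sequence $(u_n)$. $F$ satisfies condition $\Delta_0$ if $\lim_{x\to F_*-}\frac{\Delta F(x)}{1-F(x)}=0$ (the limit is $x\to+\infty$ if $F_*=+\infty$);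 for $\xi>0$ it satisfies condition $\Delta_\xi$ if $\sup_{x<F_*}\frac{\Delta F(x)}{(1-F(x))^{1+\xi}}<+\infty$. Theorem. Suppose that $(X_j)$ is strictly stationary and $\alpha$-mixing and that $F$ is continuous at $F_*$ (which holds automatically if $F_*=+\infty$). Then $(X_j)$ admits a continuous phantom distribution function in each of the following cases: (i) $(X_j)$ is $m$-dependent for some integer $m\ge0$, that is, $\alpha(m+1)=0$, and $F$ satisfies $\Delta_0$; (ii) there are constants $C>0$ and $\rho\in[0,1)$ with $\alpha(n)\le C\rho^n$ for all $n\ge1$, and $F$ satisfies $\Delta_\xi$ for some $\xi>0$; (iii) there are constants $C>0$ and $\beta>0$ with $\alpha(n)\le Cn^{-\beta}$ for all $n\ge1$, and $F$ satisfies $\Delta_\xi$ for some $\xi>1/\beta$. -/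

import Mathlib

open MeasureTheory ProbabilityTheory Filter Topology

noncomputable section

/-- Strict stationarity: the law of the whole sequence is invariant under every time shift.
Sequences are indexed from `0`, so that the variables `X₁, X₂, …` are `X 0, X 1, …`. -/
def StrictlyStationary {Ω : Type*} [MeasurableSpace Ω] (μ : Measure Ω) (X : ℕ → Ω → ℝ) : Prop :=
  ∀ k : ℕ, IdentDistrib (fun ω (j : ℕ) => X (j + k) ω) (fun ω (j : ℕ) => X j ω) μ μ

/-- Bounded measurable non-constant functions on `ℝ^s` with supremum norm at most `1`. -/
def IsTestFunction {s : ℕ} (f : (Fin s → ℝ) → ℝ) : Prop :=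
  Measurable f ∧ (∀ x, |f x| ≤ 1) ∧ ∃ x y, f x ≠ f y

/-- All normalised covariances `|Cov(f(X_{i_1},…,X_{i_s}), g(X_{j_1},…,X_{j_t}))| / 4` with
`i_1 ≤ … ≤ i_s ≤ j_1 ≤ … ≤ j_t` and `j_1 - i_s ≥ r`. -/
def alphaSet {Ω : Type*} [MeasurableSpace Ω] (μ : Measure Ω) (X : ℕ → Ω → ℝ) (r : ℕ) : Set ℝ :=
  {c : ℝ | ∃ (s t : ℕ) (f : (Fin s → ℝ) → ℝ) (g : (Fin t → ℝ) → ℝ)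
      (i : Fin s → ℕ) (j : Fin t → ℕ),
      0 < s ∧ 0 < t ∧ IsTestFunction f ∧ IsTestFunction g ∧ Monotone i ∧ Monotone j ∧
      (∀ a b, i a + r ≤ j b) ∧
      c = |cov[fun ω => f (fun a => X (i a) ω), fun ω => g (fun b => X (j b) ω); μ]| / 4}

/-- The coefficient of `α`-mixing (strong mixing). -/
def alphaCoeff {Ω : Type*} [MeasurableSpace Ω] (μ : Measure Ω) (X : ℕ → Ω → ℝ) (r : ℕ) : ℝ :=
  sSup (alphaSet μ X r)

/-- The supremum defining `alphaCoeff` is that of a bounded set. -/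
theorem alphaSet_bddAbove {Ω : Type*} [MeasurableSpace Ω] (μ : Measure Ω) [IsProbabilityMeasure μ]
    (X : ℕ → Ω → ℝ) (r : ℕ) : BddAbove (alphaSet μ X r) := by
  refine ⟨1, ?_⟩
  rintro c ⟨s, t, f, g, i, j, -, -, hf, hg, -, -, -, rfl⟩
  have bd : ∀ (h : Ω → ℝ), (∀ ω, |h ω| ≤ 1) → |∫ ω, h ω ∂μ| ≤ 1 := by
    intro h hh
    have := norm_integral_le_of_norm_le_const (μ := μ) (f := h) (C := 1)
      (Eventually.of_forall hh)
    simpa using this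
  have h1 := bd (fun ω => f (fun a => X (i a) ω)) (fun ω => hf.2.1 _)
  have h2 := bd (fun ω => g (fun b => X (j b) ω)) (fun ω => hg.2.1 _)
  have key : |cov[fun ω => f (fun a => X (i a) ω), fun ω => g (fun b => X (j b) ω); μ]| ≤ 4 := by
    unfold covariance
    have := norm_integral_le_of_norm_le_const (μ := μ) (C := 4)
      (f := fun ω => (f (fun a => X (i a) ω) - ∫ ω, f (fun a => X (i a) ω) ∂μ) *
        (g (fun b => X (j b) ω) - ∫ ω, g (fun b => X (j b) ω) ∂μ))
      (Eventually.of_forall fun ω => by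
        rw [Real.norm_eq_abs, abs_mul]
        have a1 := (abs_sub (f (fun a => X (i a) ω)) (∫ ω, f (fun a => X (i a) ω) ∂μ)).trans
          (add_le_add (hf.2.1 _) h1)
        have a2 := (abs_sub (g (fun b => X (j b) ω)) (∫ ω, g (fun b => X (j b) ω) ∂μ)).trans
          (add_le_add (hg.2.1 _) h2)
        have := mul_le_mul a1 a2 (abs_nonneg _) (by norm_num)
        linarith)
    simpa using this
  linarith

/-- `α`-mixing: the coefficients of `α`-mixing tend to zero. -/
def IsAlphaMixing {Ω : Type*} [MeasurableSpace Ω] (μ : Measure Ω) (X : ℕ → Ω → ℝ) : Prop :=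
  Tendsto (alphaCoeff μ X) atTop (𝓝 0)

/-- The marginal distribution function `F(x) = P(X₁ ≤ x)`. -/
def marginalDF {Ω : Type*} [MeasurableSpace Ω] (μ : Measure Ω) (X : ℕ → Ω → ℝ) : ℝ → ℝ :=
  fun x => cdf (μ.map (X 0)) x

/-- The partial maximum `M_n = max (X₁, …, X_n)` (for `n ≥ 1`). -/
def partialMax {Ω : Type*} (X : ℕ → Ω → ℝ) (n : ℕ) (ω : Ω) : ℝ :=
  ⨆ j : Fin n, X j ω

/-- `G` is a phantom distribution function of the sequence `X`: `P(M_n ≤ u_n) - G(u_n)^n → 0`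
for every real sequence `u_n`. -/
def IsPhantomDF {Ω : Type*} [MeasurableSpace Ω] (μ : Measure Ω) (X : ℕ → Ω → ℝ) (G : ℝ → ℝ) :
    Prop :=
  ∀ u : ℕ → ℝ,
    Tendsto (fun n : ℕ => μ.real {ω | partialMax X n ω ≤ u n} - G (u n) ^ n) atTop (𝓝 0)

/-- The sequence admits a continuous phantom distribution function, that is, one which is the
distribution function of a probability measure on the line and is continuous. -/
def AdmitsContinuousPhantomDF {Ω : Type*} [MeasurableSpace Ω] (μ : Measure Ω) (X : ℕ → Ω → ℝ) :
    Prop :=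
  ∃ ν : Measure ℝ, IsProbabilityMeasure ν ∧ Continuous (cdf ν) ∧ IsPhantomDF μ X (cdf ν)

/-- The right end `F_* = sup {x | F x < 1}`, possibly `+∞`. -/
def rightEnd (F : ℝ → ℝ) : EReal :=
  sSup ((fun x : ℝ => (x : EReal)) '' {x : ℝ | F x < 1})

/-- `F` is continuous at its right end; when the right end is `+∞` this holds automatically,
since `F` tends to `1` there. -/
def ContinuousAtRightEnd (F : ℝ → ℝ) : Prop :=
  ∀ x : ℝ, (x : EReal) = rightEnd F → ContinuousAt F x

/-- The jump `ΔF(x) = F(x) - F(x-)`. -/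
def jump (F : ℝ → ℝ) (x : ℝ) : ℝ :=
  F x - Function.leftLim F x

/-- Condition `Δ₀`: `ΔF(x) / (1 - F(x)) → 0` as the real `x` tends to `F_*` from the left
(as `x → +∞` if `F_* = +∞`). -/
def DeltaZero (F : ℝ → ℝ) : Prop :=
  Tendsto (fun x : ℝ => jump F x / (1 - F x))
    (comap (fun x : ℝ => (x : EReal)) (𝓝[<] rightEnd F)) (𝓝 0)

/-- Condition `Δ_ξ`: `ΔF(x) / (1 - F(x))^(1+ξ)` is bounded over all `x < F_*`. -/
def DeltaXi (F : ℝ → ℝ) (ξ : ℝ) : Prop :=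
  ∃ M : ℝ, ∀ x : ℝ, (x : EReal) < rightEnd F → jump F x / (1 - F x) ^ (1 + ξ) ≤ M

end

/-! Write `b_n(x)` for `P(M_n ≤ x)`. Deleting a gap of `r` variables between two blocks costs `r (1
- F x)`, and decoupling the blocks costs `α(r)`. So at levels where `F` is close to `1`, `b_{p+q} ≈
b_p b_q` uniformly in `p, q`, and `n ↦ b_n(x)` is nearly exponential (`tendsto_maxDF_of_ratio`).

Let `v_n` be the `e⁻¹`-quantile of `M_n`. Suppose `F(v_n) → 1` and `b_n(v_n) → e⁻¹`. Spreading the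
increments of `exp(-1/n)` over the gaps between levels gives a continuous `G` with `G(v_n)^n → e⁻¹`.
At `v_k` with `k ≈ n/s`, `s` rational, both `b_n` and `G^n` tend to `e^{-s}`; as both are monotone
in the level, they agree asymptotically along every `u_n` (`tendsto_sub_of_common_limits`).

Only the jumps of `F` obstruct `b_n(v_n) → e⁻¹`: the overshoot is at most `n ΔF(v_n)`. Thinning to a
grid of mesh `r` gives `e⁻¹ ≤ F(v_n)^k + k α(r)` for `k r ≤ n`, hence `1 - F(v_n) ≤ 2/k` once `k
α(r) ≤ e⁻¹/2`. Each mixing rate fixes the best mesh `r`, and the matching condition on `ΔF` makes `n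
ΔF(v_n)` vanish. The geometric case reduces to the polynomial one. -/

theorem partialMax_le_iff {Ω : Type*} {X : ℕ → Ω → ℝ} {n : ℕ} (hn : 0 < n) (ω : Ω) (x : ℝ) :
    partialMax X n ω ≤ x ↔ ∀ j < n, X j ω ≤ x := by
  have : Nonempty (Fin n) := ⟨⟨0, hn⟩⟩
  unfold partialMax
  rw [ciSup_le_iff (Set.finite_range _).bddAbove]
  exact ⟨fun h j hj => h ⟨j, hj⟩, fun h j => h j j.2⟩

/-! ### Distribution functions of maxima: union bounds and mixing. -/

section MaxDF

variable {Ω : Type*} [MeasurableSpace Ω] {μ : Measure Ω} {X : ℕ → Ω → ℝ}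

/-- The distribution function `P(X₁ ≤ x, …, X_n ≤ x)` of the partial maximum. -/
noncomputable def maxDF (μ : Measure Ω) (X : ℕ → Ω → ℝ) (n : ℕ) (x : ℝ) : ℝ :=
  μ.real {ω | ∀ j < n, X j ω ≤ x}

theorem real_partialMax_le {n : ℕ} (hn : 0 < n) (x : ℝ) :
    μ.real {ω | partialMax X n ω ≤ x} = maxDF μ X n x := by
  simp only [maxDF, partialMax_le_iff hn]

theorem measurableSet_forall_le (hX : ∀ j, Measurable (X j)) {ι : Type*} [Countable ι]
    (i : ι → ℕ) (x : ℝ) : MeasurableSet {ω | ∀ a, X (i a) ω ≤ x} := by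
  rw [Set.ofPred_forall]
  exact MeasurableSet.iInter fun a => measurableSet_le (hX _) measurable_const

theorem measurableSet_forall_lt_le (hX : ∀ j, Measurable (X j)) (f : ℕ → ℕ) (n : ℕ) (x : ℝ) :
    MeasurableSet {ω | ∀ j < n, X (f j) ω ≤ x} := by
  simp only [Set.ofPred_forall]
  exact MeasurableSet.iInter fun a => MeasurableSet.iInter fun _ =>
    measurableSet_le (hX _) measurable_const

theorem StrictlyStationary.real_shift (hstat : StrictlyStationary μ X) (p q : ℕ) (x : ℝ) :
    μ.real {ω | ∀ j < q, X (j + p) ω ≤ x} = maxDF μ X q x := by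
  have hS : MeasurableSet {y : ℕ → ℝ | ∀ j < q, y j ≤ x} :=
    measurableSet_forall_lt_le (X := fun j (y : ℕ → ℝ) => y j) (fun j => measurable_pi_apply j)
      (fun j => j) q x
  have := (hstat p).measure_mem_eq hS
  exact congrArg ENNReal.toReal this

theorem StrictlyStationary.real_le (hstat : StrictlyStationary μ X) [IsProbabilityMeasure μ]
    (hX : ∀ j, Measurable (X j)) (j : ℕ) (x : ℝ) :
    μ.real {ω | X j ω ≤ x} = marginalDF μ X x := by
  have := Measure.isProbabilityMeasure_map (μ := μ) (hX 0).aemeasurable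
  have h1 := hstat.real_shift j 1 x
  have h2 : marginalDF μ X x = maxDF μ X 1 x := by
    simp only [marginalDF, cdf_eq_real, maxDF]
    rw [map_measureReal_apply (hX 0) measurableSet_Iic]
    simp [Set.preimage]
  rw [h2, ← h1]
  simp

theorem marginalDF_nonneg (x : ℝ) : 0 ≤ marginalDF μ X x := cdf_nonneg _ _

theorem marginalDF_le_one (x : ℝ) : marginalDF μ X x ≤ 1 := cdf_le_one _ _

theorem marginalDF_mono : Monotone (marginalDF μ X) := monotone_cdf _

theorem maxDF_nonneg (n : ℕ) (x : ℝ) : 0 ≤ maxDF μ X n x := measureReal_nonneg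

theorem alphaCoeff_nonneg (r : ℕ) : 0 ≤ alphaCoeff μ X r := by
  refine Real.sSup_nonneg ?_
  rintro c ⟨s, t, f, g, i, j, -, -, -, -, -, -, -, rfl⟩
  positivity

variable [IsProbabilityMeasure μ]

theorem maxDF_zero (x : ℝ) : maxDF μ X 0 x = 1 := by simp [maxDF]

theorem maxDF_le_one (n : ℕ) (x : ℝ) : maxDF μ X n x ≤ 1 := measureReal_le_one

theorem maxDF_mono (n : ℕ) : Monotone (maxDF μ X n) := fun _ _ h =>
  measureReal_mono fun _ hω j hj => (hω j hj).trans h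

theorem maxDF_anti (x : ℝ) : Antitone (fun n => maxDF μ X n x) := fun _ _ h =>
  measureReal_mono fun _ hω j hj => hω j (hj.trans_le h)

theorem maxDF_one (hstat : StrictlyStationary μ X) (hX : ∀ j, Measurable (X j)) (x : ℝ) :
    maxDF μ X 1 x = marginalDF μ X x := by
  rw [← hstat.real_le hX 0 x]
  simp [maxDF]

/-- Relaxing finitely many constraints `X j ≤ x` to `X j ≤ y`. -/
theorem real_forall_le_sub (hstat : StrictlyStationary μ X) (hX : ∀ j, Measurable (X j))
    {x y : ℝ} (hxy : x ≤ y) (n : ℕ) :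
    maxDF μ X n y - maxDF μ X n x ≤ n * (marginalDF μ X y - marginalDF μ X x) := by
  have hsub : {ω | ∀ j < n, X j ω ≤ y} ⊆
      {ω | ∀ j < n, X j ω ≤ x} ∪ ⋃ j ∈ Finset.range n, ({ω | X j ω ≤ y} \ {ω | X j ω ≤ x}) := by
    intro ω hω
    by_cases h : ∀ j < n, X j ω ≤ x
    · exact Or.inl h
    · push Not at h
      obtain ⟨j, hj, hj'⟩ := h
      right
      simp only [Set.mem_iUnion]
      exact ⟨j, Finset.mem_range.2 hj, hω j hj, not_le.2 hj'⟩
  have h1 := (measureReal_mono (μ := μ) hsub).trans (measureReal_union_le _ _)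
  have h2 := measureReal_biUnion_finset_le (μ := μ) (Finset.range n)
    (fun j => {ω | X j ω ≤ y} \ {ω | X j ω ≤ x})
  have h3 : ∀ j ∈ Finset.range n, μ.real ({ω | X j ω ≤ y} \ {ω | X j ω ≤ x}) =
      marginalDF μ X y - marginalDF μ X x := by
    intro j _
    have hs : {ω | X j ω ≤ x} ⊆ {ω | X j ω ≤ y} := fun ω (h : X j ω ≤ x) => le_trans h hxy
    rw [measureReal_sdiff hs (measurableSet_le (hX j) measurable_const), hstat.real_le hX,
      hstat.real_le hX]
  rw [Finset.sum_congr rfl h3, Finset.sum_const, Finset.card_range, nsmul_eq_mul] at h2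
  unfold maxDF
  linarith

/-- Dropping constraints `X (p + j) ≤ x`, `j < q`, from an event raises its probability by at most
`q (1 - F x)`. -/
theorem real_drop_le (hstat : StrictlyStationary μ X) (hX : ∀ j, Measurable (X j))
    (x : ℝ) (p q : ℕ) (A B : Set Ω) (h : ∀ ω ∈ B, (∀ j < q, X (j + p) ω ≤ x) → ω ∈ A) :
    μ.real B ≤ μ.real A + q * (1 - marginalDF μ X x) := by
  have hsub : B ⊆ A ∪ ⋃ j ∈ Finset.range q, {ω | X (j + p) ω ≤ x}ᶜ := by
    intro ω hω
    by_cases h' : ∀ j < q, X (j + p) ω ≤ x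
    · exact Or.inl (h ω hω h')
    · push Not at h'
      obtain ⟨j, hj, hj'⟩ := h'
      right
      simp only [Set.mem_iUnion]
      exact ⟨j, Finset.mem_range.2 hj, not_le.2 hj'⟩
  have h1 := (measureReal_mono (μ := μ) hsub).trans (measureReal_union_le _ _)
  have h2 := measureReal_biUnion_finset_le (μ := μ) (Finset.range q)
    (fun j => {ω | X (j + p) ω ≤ x}ᶜ)
  have h3 : ∀ j ∈ Finset.range q, μ.real ({ω | X (j + p) ω ≤ x}ᶜ) = 1 - marginalDF μ X x := by
    intro j _
    rw [probReal_compl_eq_one_sub (measurableSet_le (hX _) measurable_const), hstat.real_le hX]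
  rw [Finset.sum_congr rfl h3, Finset.sum_const, Finset.card_range, nsmul_eq_mul] at h2
  linarith

theorem maxDF_le_add (hstat : StrictlyStationary μ X) (hX : ∀ j, Measurable (X j))
    (x : ℝ) (p q : ℕ) :
    maxDF μ X p x ≤ maxDF μ X (p + q) x + q * (1 - marginalDF μ X x) := by
  refine real_drop_le hstat hX x p q _ _ fun ω hω h j hj => ?_
  rcases lt_or_ge j p with h1 | h1
  · exact hω j h1
  · have := h (j - p) (by omega)
    rwa [Nat.sub_add_cancel h1] at this

theorem abs_maxDF_sub_le (hstat : StrictlyStationary μ X) (hX : ∀ j, Measurable (X j))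
    (x : ℝ) {m n J : ℕ} (h1 : m ≤ n + J) (h2 : n ≤ m + J) :
    |maxDF μ X m x - maxDF μ X n x| ≤ J * (1 - marginalDF μ X x) := by
  have a1 := maxDF_le_add hstat hX x m J
  have a2 := maxDF_le_add hstat hX x n J
  have a3 : maxDF μ X (m + J) x ≤ maxDF μ X n x := maxDF_anti x h2
  have a4 : maxDF μ X (n + J) x ≤ maxDF μ X m x := maxDF_anti x h1
  rw [abs_le]
  constructor <;> linarith

/-- The indicator of an orthant, rescaled to take the values `±1`. -/
noncomputable def orthantTest (s : ℕ) (x : ℝ) (y : Fin s → ℝ) : ℝ :=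
  2 * Set.indicator {y : Fin s → ℝ | ∀ a, y a ≤ x} 1 y - 1

theorem isTestFunction_orthantTest {s : ℕ} (hs : 0 < s) (x : ℝ) :
    IsTestFunction (orthantTest s x) := by
  refine ⟨?_, fun y => ?_, fun _ => x, fun _ => x + 1, ?_⟩
  · have : MeasurableSet {y : Fin s → ℝ | ∀ a, y a ≤ x} := by
      rw [Set.ofPred_forall]
      exact MeasurableSet.iInter fun a => measurableSet_le (measurable_pi_apply a) measurable_const
    exact ((measurable_one.indicator this).const_mul 2).sub_const 1
  · unfold orthantTest Set.indicator
    split_ifs <;> norm_num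
  · have h1 : orthantTest s x (fun _ => x) = 1 := by
      unfold orthantTest
      rw [Set.indicator_of_mem (by simp)]
      norm_num
    have h2 : orthantTest s x (fun _ => x + 1) = -1 := by
      unfold orthantTest
      rw [Set.indicator_of_notMem]
      · norm_num
      · intro h
        have := h ⟨0, hs⟩
        simp only at this
        linarith
    rw [h1, h2]
    norm_num

/-- The covariance of rescaled indicators. -/
theorem covariance_two_indicator_sub_one {A B : Set Ω} (hA : MeasurableSet A)
    (hB : MeasurableSet B) :
    cov[fun ω => 2 * A.indicator (1 : Ω → ℝ) ω - 1, fun ω => 2 * B.indicator (1 : Ω → ℝ) ω - 1; μ]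
      = 4 * (μ.real (A ∩ B) - μ.real A * μ.real B) := by
  have iA : MemLp (A.indicator (1 : Ω → ℝ)) 2 μ :=
    memLp_indicator_const 2 hA (1 : ℝ) (Or.inr (measure_ne_top _ _))
  have iB : MemLp (B.indicator (1 : Ω → ℝ)) 2 μ :=
    memLp_indicator_const 2 hB (1 : ℝ) (Or.inr (measure_ne_top _ _))
  have iA2 : Integrable (fun ω => 2 * A.indicator (1 : Ω → ℝ) ω) μ :=
    (iA.integrable (by norm_num)).const_mul 2
  have iB2 : Integrable (fun ω => 2 * B.indicator (1 : Ω → ℝ) ω) μ :=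
    (iB.integrable (by norm_num)).const_mul 2
  rw [covariance_sub_const_left iA2, covariance_sub_const_right iB2,
    covariance_const_mul_left, covariance_const_mul_right,
    covariance_eq_sub iA iB, integral_indicator_one hA, integral_indicator_one hB]
  have : A.indicator (1 : Ω → ℝ) * B.indicator 1 = (A ∩ B).indicator 1 := by
    rw [Set.inter_indicator_one]
  rw [this, integral_indicator_one (hA.inter hB)]
  ring

/-- With indicators rescaled to `±1`, the covariance is four times the defect of independence, which
cancels the normalisation `1/4` of the mixing coefficient. -/
theorem abs_real_inter_sub_le_alphaCoeff (hX : ∀ j, Measurable (X j)) {s t r : ℕ} (hs : 0 < s)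
    (ht : 0 < t) {i : Fin s → ℕ} {j : Fin t → ℕ} (hi : Monotone i) (hj : Monotone j)
    (hij : ∀ a b, i a + r ≤ j b) (x : ℝ) :
    |μ.real ({ω | ∀ a, X (i a) ω ≤ x} ∩ {ω | ∀ b, X (j b) ω ≤ x}) -
      μ.real {ω | ∀ a, X (i a) ω ≤ x} * μ.real {ω | ∀ b, X (j b) ω ≤ x}| ≤ alphaCoeff μ X r := by
  refine le_csSup (alphaSet_bddAbove μ X r) ⟨s, t, orthantTest s x, orthantTest t x, i, j, hs, ht,
    isTestFunction_orthantTest hs x, isTestFunction_orthantTest ht x, hi, hj, hij, ?_⟩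
  have := covariance_two_indicator_sub_one (μ := μ) (measurableSet_forall_le hX i x)
    (measurableSet_forall_le hX j x)
  change _ = |cov[fun ω => 2 * Set.indicator {ω | ∀ a, X (i a) ω ≤ x} (1 : Ω → ℝ) ω - 1,
    fun ω => 2 * Set.indicator {ω | ∀ b, X (j b) ω ≤ x} (1 : Ω → ℝ) ω - 1; μ]| / 4
  rw [this, abs_mul]
  norm_num

/-- The probability that the variables on a grid of mesh `r` stay below a level. -/
theorem real_grid_le (hstat : StrictlyStationary μ X) (hX : ∀ j, Measurable (X j))
    (x : ℝ) (r k : ℕ) :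
    μ.real {ω | ∀ l < k, X (l * r) ω ≤ x} ≤ marginalDF μ X x ^ k + k * alphaCoeff μ X r := by
  induction k with
  | zero => simp
  | succ k ih =>
    have hα := alphaCoeff_nonneg (μ := μ) (X := X) r
    have hF := marginalDF_nonneg (μ := μ) (X := X) x
    have hF1 := marginalDF_le_one (μ := μ) (X := X) x
    -- The mixing coefficient only compares nonempty blocks, so a single grid point is treated
    -- directly.
    rcases Nat.eq_zero_or_pos k with rfl | hk
    · have h := hstat.real_le hX 0 x
      simp only [zero_add, Nat.lt_one_iff, forall_eq, zero_mul, pow_one, h]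
      push_cast
      linarith
    have h := abs_real_inter_sub_le_alphaCoeff (μ := μ) hX hk one_pos
      (i := fun a : Fin k => a * r) (j := fun _ : Fin 1 => k * r) (r := r)
      (fun a b hab => Nat.mul_le_mul_right r hab) monotone_const
      (fun a _ => by
        have := Nat.mul_le_mul_right r a.2
        simpa [Nat.succ_mul] using this) x
    have e1 : {ω | ∀ a : Fin k, X (a * r) ω ≤ x} ∩ {ω | ∀ _ : Fin 1, X (k * r) ω ≤ x} =
        {ω | ∀ l < k + 1, X (l * r) ω ≤ x} := by
      ext ω
      simp only [Set.mem_inter_iff, Set.mem_ofPred_eq, Nat.lt_succ_iff_lt_or_eq, forall_const,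
        Fin.forall_iff]
      exact ⟨fun h l hl => hl.elim (h.1 l) (fun e => e ▸ h.2),
        fun h => ⟨fun l hl => h l (Or.inl hl), h k (Or.inr rfl)⟩⟩
    have e2 : {ω | ∀ a : Fin k, X (a * r) ω ≤ x} = {ω | ∀ l < k, X (l * r) ω ≤ x} := by
      simp only [Fin.forall_iff]
    have e3 : μ.real {ω | ∀ _ : Fin 1, X (k * r) ω ≤ x} = marginalDF μ X x := by
      simp only [forall_const, hstat.real_le hX]
    rw [e1, e3, e2] at h
    have h' := (abs_le.1 h).2
    have h'' := mul_le_mul_of_nonneg_right ih hF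
    have : (k : ℝ) * alphaCoeff μ X r * marginalDF μ X x ≤ k * alphaCoeff μ X r :=
      mul_le_of_le_one_right (by positivity) hF1
    rw [pow_succ]
    push_cast
    linarith

theorem maxDF_le_pow_add (hstat : StrictlyStationary μ X) (hX : ∀ j, Measurable (X j))
    (x : ℝ) {n r k : ℕ} (hr : 0 < r) (h : k * r ≤ n) :
    maxDF μ X n x ≤ marginalDF μ X x ^ k + k * alphaCoeff μ X r := by
  refine (measureReal_mono fun ω hω l hl => ?_).trans (real_grid_le hstat hX x r k)
  exact hω _ (((Nat.mul_lt_mul_right hr).2 hl).trans_le h)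

/-- Approximate multiplicativity of the distribution functions of partial maxima. -/
theorem abs_maxDF_add_sub_mul_le (hstat : StrictlyStationary μ X) (hX : ∀ j, Measurable (X j))
    (x : ℝ) (p q r : ℕ) :
    |maxDF μ X (p + q) x - maxDF μ X p x * maxDF μ X q x| ≤
      alphaCoeff μ X r + 2 * r * (1 - marginalDF μ X x) := by
  have hα := alphaCoeff_nonneg (μ := μ) (X := X) r
  have hF : 0 ≤ 1 - marginalDF μ X x := sub_nonneg.2 (marginalDF_le_one x)
  have hrF : 0 ≤ (r : ℝ) * (1 - marginalDF μ X x) := by positivity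
  have hp0 := maxDF_nonneg (μ := μ) (X := X) p x
  have hp1 := maxDF_le_one (μ := μ) (X := X) p x
  have hq0 := maxDF_nonneg (μ := μ) (X := X) q x
  have hq1 := maxDF_le_one (μ := μ) (X := X) q x
  rcases Nat.eq_zero_or_pos p with rfl | hp
  · rw [zero_add, maxDF_zero, one_mul, sub_self, abs_zero]
    linarith
  rcases le_or_gt q r with hqr | hqr
  -- The second block is too short to contain a gap of length `r`, but then `b_q` is within `r (1 -
  -- F x)` of `1`.
  · have h1 := maxDF_le_add hstat hX x p q
    have h2 := maxDF_le_add hstat hX x 0 q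
    have h3 : maxDF μ X (p + q) x ≤ maxDF μ X p x := maxDF_anti x (Nat.le_add_right p q)
    rw [zero_add, maxDF_zero] at h2
    have h4 : (q : ℝ) * (1 - marginalDF μ X x) ≤ r * (1 - marginalDF μ X x) := by gcongr
    have h5 : maxDF μ X p x * (1 - maxDF μ X q x) ≤ 1 - maxDF μ X q x :=
      mul_le_of_le_one_left (by linarith) hp1
    have h6 : 0 ≤ maxDF μ X p x * (1 - maxDF μ X q x) := mul_nonneg hp0 (by linarith)
    rw [abs_le]
    constructor <;> linarith
  -- The gap is cut from the start of the second block. Its cost `r (1 - F x)` is paid once in the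
  -- joint event and once in replacing `b_{q-r}` by `b_q`.
  · have h := abs_real_inter_sub_le_alphaCoeff (μ := μ) hX hp (Nat.sub_pos_of_lt hqr)
      (i := fun a : Fin p => (a : ℕ)) (j := fun b : Fin (q - r) => b + (p + r)) (r := r)
      (fun a b hab => hab) (fun a b hab => Nat.add_le_add_right hab _)
      (fun a b => by have := a.2; omega) x
    have e1 : {ω | ∀ a : Fin p, X a ω ≤ x} = {ω | ∀ l < p, X l ω ≤ x} := by
      simp only [Fin.forall_iff]
    have e2 : {ω | ∀ b : Fin (q - r), X (b + (p + r)) ω ≤ x} =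
        {ω | ∀ b < q - r, X (b + (p + r)) ω ≤ x} := by
      simp only [Fin.forall_iff]
    rw [e1, e2, hstat.real_shift] at h
    change |_ - maxDF μ X p x * _| ≤ _ at h
    set E := {ω | ∀ l < p, X l ω ≤ x} ∩ {ω | ∀ b < q - r, X (b + (p + r)) ω ≤ x}
    have h1 : maxDF μ X (p + q) x ≤ μ.real E := by
      refine measureReal_mono fun ω hω => ⟨fun l hl => hω l (by omega), fun b hb => ?_⟩
      exact hω _ (by omega)
    have h2 : μ.real E ≤ maxDF μ X (p + q) x + r * (1 - marginalDF μ X x) := by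
      refine real_drop_le hstat hX x p r _ _ fun ω hω h j hj => ?_
      rcases lt_or_ge j p with h1 | h1
      · exact hω.1 j h1
      rcases lt_or_ge j (p + r) with h2 | h2
      · have := h (j - p) (by omega)
        rwa [Nat.sub_add_cancel h1] at this
      · have := hω.2 (j - (p + r)) (by omega)
        rwa [Nat.sub_add_cancel h2] at this
    have h3 := maxDF_le_add hstat hX x (q - r) r
    rw [Nat.sub_add_cancel hqr.le] at h3
    have h4 : maxDF μ X q x ≤ maxDF μ X (q - r) x := maxDF_anti x (Nat.sub_le q r)
    have h5 : maxDF μ X p x * (maxDF μ X (q - r) x - maxDF μ X q x) ≤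
        maxDF μ X (q - r) x - maxDF μ X q x := mul_le_of_le_one_left (by linarith) hp1
    have h6 : 0 ≤ maxDF μ X p x * (maxDF μ X (q - r) x - maxDF μ X q x) :=
      mul_nonneg hp0 (by linarith)
    have h7 := abs_le.1 h
    rw [abs_le]
    constructor <;> linarith

end MaxDF

/-! ### Quantiles of the maxima and the tail of `F` there. -/

section Quantile

variable {Ω : Type*} [MeasurableSpace Ω] {μ : Measure Ω} {X : ℕ → Ω → ℝ}

theorem marginalDF_tendsto_atBot : Tendsto (marginalDF μ X) atBot (𝓝 0) := tendsto_cdf_atBot _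

theorem marginalDF_tendsto_atTop : Tendsto (marginalDF μ X) atTop (𝓝 1) := tendsto_cdf_atTop _

theorem marginalDF_rightCont (x : ℝ) : Tendsto (marginalDF μ X) (𝓝[>] x) (𝓝 (marginalDF μ X x)) :=
  (((cdf (μ.map (X 0))).right_continuous x).mono Set.Ioi_subset_Ici_self).tendsto

theorem lt_one_of_lt_rightEnd {F : ℝ → ℝ} (hF : Monotone F) {x : ℝ}
    (hx : (x : EReal) < rightEnd F) : F x < 1 := by
  obtain ⟨_, ⟨y, hy, rfl⟩, hxy⟩ := lt_sSup_iff.1 hx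
  exact (hF (EReal.coe_lt_coe_iff.1 hxy).le).trans_lt hy

theorem coe_le_rightEnd {F : ℝ → ℝ} {x : ℝ} (hx : F x < 1) : (x : EReal) ≤ rightEnd F :=
  le_sSup ⟨x, hx, rfl⟩

/-- If `F` is continuous at its right end, then it takes values close to `1` before it. -/
theorem exists_lt_rightEnd (hcont : ContinuousAtRightEnd (marginalDF μ X)) {ε : ℝ} (hε : 0 < ε) :
    ∃ y : ℝ, (y : EReal) < rightEnd (marginalDF μ X) ∧ 1 - marginalDF μ X y < ε := by
  have hne : rightEnd (marginalDF μ X) ≠ ⊥ := by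
    obtain ⟨x, hx⟩ :=
      ((marginalDF_tendsto_atBot (μ := μ) (X := X)).eventually (gt_mem_nhds one_pos)).exists
    exact ((EReal.bot_lt_coe x).trans_le (coe_le_rightEnd hx)).ne'
  induction hR : rightEnd (marginalDF μ X) with
  | bot => exact absurd hR hne
  | top =>
    obtain ⟨x, hx⟩ := ((marginalDF_tendsto_atTop (μ := μ) (X := X)).eventually
      (lt_mem_nhds (show 1 - ε < 1 by linarith))).exists
    exact ⟨x, EReal.coe_lt_top x, by linarith⟩
  | coe c =>
    have hc := hcont c hR.symm
    -- `F` is `1` to the right of a finite right end, hence at it by right continuity; the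
    -- continuity hypothesis then controls `F` from the left.
    have h1 : marginalDF μ X c = 1 := by
      refine tendsto_nhds_unique (marginalDF_rightCont c) (tendsto_const_nhds.congr' ?_)
      filter_upwards [self_mem_nhdsWithin] with x hx
      by_contra h
      have h' := coe_le_rightEnd (lt_of_le_of_ne (marginalDF_le_one x) (Ne.symm h))
      rw [hR, EReal.coe_le_coe_iff] at h'
      exact absurd hx (not_lt.2 h')
    have h2 : ∀ᶠ x in 𝓝[<] c, 1 - ε < marginalDF μ X x :=
      (hc.tendsto.mono_left nhdsWithin_le_nhds).eventually (lt_mem_nhds (by rw [h1]; linarith))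
    obtain ⟨x, hx, hxc⟩ := (h2.and self_mem_nhdsWithin).exists
    exact ⟨x, EReal.coe_lt_coe_iff.2 hxc, by linarith⟩

/-- The `e⁻¹`-quantile of the `n`-th partial maximum. -/
noncomputable def maxQuantile (μ : Measure Ω) (X : ℕ → Ω → ℝ) (n : ℕ) : ℝ :=
  sInf {x | Real.exp (-1) ≤ maxDF μ X (max n 1) x}

variable [IsProbabilityMeasure μ]

theorem maxDF_le_marginalDF (hstat : StrictlyStationary μ X) (hX : ∀ j, Measurable (X j))
    {n : ℕ} (hn : 1 ≤ n) (x : ℝ) : maxDF μ X n x ≤ marginalDF μ X x := by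
  rw [← maxDF_one hstat hX]
  exact maxDF_anti x hn

theorem bddBelow_exp_le_maxDF (hstat : StrictlyStationary μ X) (hX : ∀ j, Measurable (X j))
    {n : ℕ} (hn : 1 ≤ n) : BddBelow {x | Real.exp (-1) ≤ maxDF μ X n x} := by
  obtain ⟨y, hy⟩ := ((marginalDF_tendsto_atBot (μ := μ) (X := X)).eventually
    (gt_mem_nhds (Real.exp_pos (-1)))).exists
  refine ⟨y, fun x hx => le_of_not_gt fun hxy => ?_⟩
  have h1 := maxDF_le_marginalDF hstat hX hn x
  have h2 := marginalDF_mono (μ := μ) (X := X) hxy.le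
  have h3 : Real.exp (-1) ≤ maxDF μ X n x := hx
  linarith

/-- By the union bound `b_n(y) ≥ 1 - n (1 - F y)`, and continuity at the right end makes `1 - F y`
small strictly before it. -/
theorem exists_exp_le_maxDF (hstat : StrictlyStationary μ X) (hX : ∀ j, Measurable (X j))
    (hcont : ContinuousAtRightEnd (marginalDF μ X)) (n : ℕ) :
    ∃ y : ℝ, (y : EReal) < rightEnd (marginalDF μ X) ∧ Real.exp (-1) ≤ maxDF μ X n y := by
  have he : Real.exp (-1) < 1 := Real.exp_lt_one_iff.2 (by norm_num)
  obtain ⟨y, hy, hy'⟩ := exists_lt_rightEnd hcont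
    (show 0 < (1 - Real.exp (-1)) / (n + 1) from div_pos (by linarith) (by positivity))
  refine ⟨y, hy, ?_⟩
  have h1 := maxDF_le_add hstat hX y 0 n
  rw [zero_add, maxDF_zero] at h1
  rw [lt_div_iff₀ (by positivity)] at hy'
  have := marginalDF_le_one (μ := μ) (X := X) y
  linarith

/-- Strictness keeps `1 - F` positive at the quantile and makes the conditions on the jumps, which
concern only `x < F_*`, applicable. -/
theorem maxQuantile_lt_rightEnd (hstat : StrictlyStationary μ X) (hX : ∀ j, Measurable (X j))
    (hcont : ContinuousAtRightEnd (marginalDF μ X)) (n : ℕ) :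
    (maxQuantile μ X n : EReal) < rightEnd (marginalDF μ X) := by
  obtain ⟨y, hy, hy'⟩ := exists_exp_le_maxDF hstat hX hcont (max n 1)
  refine lt_of_le_of_lt (EReal.coe_le_coe_iff.2 ?_) hy
  exact csInf_le (bddBelow_exp_le_maxDF hstat hX (le_max_right n 1)) hy'

/-- The truncation `max n 1` matters at `n = 0`: the empty maximum would give the unbounded set `ℝ`,
whose infimum has the default value `0`. -/
theorem maxQuantile_mono (hstat : StrictlyStationary μ X) (hX : ∀ j, Measurable (X j))
    (hcont : ContinuousAtRightEnd (marginalDF μ X)) : Monotone (maxQuantile μ X) := by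
  intro m n hmn
  obtain ⟨y, _, hy⟩ := exists_exp_le_maxDF hstat hX hcont (max n 1)
  refine csInf_le_csInf (bddBelow_exp_le_maxDF hstat hX (le_max_right m 1)) ⟨y, hy⟩ fun x hx => ?_
  exact le_trans hx (maxDF_anti x (max_le_max_right 1 hmn))

/-- `b_n` inherits right continuity from `F`, since its increments are at most `n` times those of
`F`. -/
theorem exp_le_maxDF_maxQuantile (hstat : StrictlyStationary μ X) (hX : ∀ j, Measurable (X j))
    (hcont : ContinuousAtRightEnd (marginalDF μ X)) {n : ℕ} (hn : 1 ≤ n) :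
    Real.exp (-1) ≤ maxDF μ X n (maxQuantile μ X n) := by
  set v := maxQuantile μ X n with hv
  rw [maxQuantile, max_eq_left hn] at hv
  obtain ⟨y, _, hy⟩ := exists_exp_le_maxDF hstat hX hcont n
  have hlim : Tendsto (fun y => maxDF μ X n v + n * (marginalDF μ X y - marginalDF μ X v))
      (𝓝[>] v) (𝓝 (maxDF μ X n v + n * (marginalDF μ X v - marginalDF μ X v))) :=
    (((marginalDF_rightCont v).sub_const _).const_mul _).const_add _
  rw [sub_self, mul_zero, add_zero] at hlim
  refine ge_of_tendsto hlim ?_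
  filter_upwards [self_mem_nhdsWithin] with z hz
  have hz' : v < z := hz
  rw [hv] at hz'
  obtain ⟨w, hw, hwz⟩ := exists_lt_of_csInf_lt ⟨y, hy⟩ hz'
  have h1 : Real.exp (-1) ≤ maxDF μ X n w := hw
  have h2 := maxDF_mono (μ := μ) (X := X) n hwz.le
  have h3 := real_forall_le_sub hstat hX (le_of_lt hz) n
  linarith

/-- Strictly below the quantile `b_n < e⁻¹`, and the jump of `b_n` is at most `n` times that of `F`.
-/
theorem maxDF_maxQuantile_le (hstat : StrictlyStationary μ X) (hX : ∀ j, Measurable (X j))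
    {n : ℕ} (hn : 1 ≤ n) :
    maxDF μ X n (maxQuantile μ X n) ≤
      Real.exp (-1) + n * jump (marginalDF μ X) (maxQuantile μ X n) := by
  set v := maxQuantile μ X n with hv
  rw [maxQuantile, max_eq_left hn] at hv
  have hlim : Tendsto (fun y => Real.exp (-1) + n * (marginalDF μ X v - marginalDF μ X y))
      (𝓝[<] v) (𝓝 (Real.exp (-1) + n * jump (marginalDF μ X) v)) :=
    ((((marginalDF_mono (μ := μ) (X := X)).tendsto_leftLim v).const_sub _).const_mul _).const_add _
  refine ge_of_tendsto hlim ?_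
  filter_upwards [self_mem_nhdsWithin] with z hz
  have h1 : maxDF μ X n z < Real.exp (-1) := by
    by_contra h
    have := csInf_le (bddBelow_exp_le_maxDF hstat hX hn) (not_lt.1 h)
    rw [← hv] at this
    exact absurd hz (not_lt.2 this)
  have h3 := real_forall_le_sub hstat hX (le_of_lt hz) n
  linarith

/-- Blocks of length `r` separated by weak dependence bound the tail at the quantile. -/
theorem mul_one_sub_marginalDF_maxQuantile_le (hstat : StrictlyStationary μ X)
    (hX : ∀ j, Measurable (X j)) (hcont : ContinuousAtRightEnd (marginalDF μ X)) {n r k : ℕ}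
    (hn : 1 ≤ n) (hr : 0 < r) (hk : k * r ≤ n) (hα : k * alphaCoeff μ X r ≤ Real.exp (-1) / 2) :
    k * (1 - marginalDF μ X (maxQuantile μ X n)) ≤ 2 := by
  have h1 := exp_le_maxDF_maxQuantile hstat hX hcont hn
  set v := maxQuantile μ X n
  have h2 := maxDF_le_pow_add hstat hX v hr hk
  have h3 : marginalDF μ X v ^ k ≤ Real.exp (-(k * (1 - marginalDF μ X v))) := by
    have := Real.add_one_le_exp (-(1 - marginalDF μ X v))
    calc marginalDF μ X v ^ k ≤ Real.exp (-(1 - marginalDF μ X v)) ^ k := by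
          gcongr
          · exact marginalDF_nonneg v
          · linarith
      _ = _ := by rw [← Real.exp_nat_mul]; ring_nf
  -- The mixing error takes at most half of `e⁻¹`, so `F(v)^k` keeps at least the other half, which
  -- exceeds `e⁻²`; this is the source of the constant `2`.
  have h4 : Real.exp (-2) ≤ Real.exp (-1) / 2 := by
    have : Real.exp (-2) = Real.exp (-1) * Real.exp (-1) := by rw [← Real.exp_add]; norm_num
    have h5 : Real.exp (-1) ≤ 1 / 2 := by
      rw [Real.exp_neg, inv_le_comm₀ (Real.exp_pos 1) (by norm_num)]
      have := Real.add_one_le_exp 1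
      norm_num at this ⊢
      exact this
    rw [this]
    nlinarith [Real.exp_pos (-1)]
  have h5 : Real.exp (-2) ≤ Real.exp (-(k * (1 - marginalDF μ X v))) := by linarith
  rw [Real.exp_le_exp] at h5
  linarith

end Quantile

/-! ### Approximately multiplicative sequences. -/

section ApproxMultiplicative

variable {ι : Type*} {l : Filter ι}

theorem abs_apply_mul_sub_pow_le {b : ℕ → ℝ} (h0 : b 0 = 1) (hb0 : ∀ n, 0 ≤ b n)
    (hb1 : ∀ n, b n ≤ 1) {ε : ℝ} (hb : ∀ p q, |b (p + q) - b p * b q| ≤ ε) (d i : ℕ) :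
    |b (i * d) - b d ^ i| ≤ i * ε := by
  induction i with
  | zero => simp [h0]
  | succ i ih =>
    have h1 := hb (i * d) d
    have h2 : |b (i * d) * b d - b d ^ i * b d| ≤ i * ε := by
      rw [← sub_mul, abs_mul, abs_of_nonneg (hb0 d)]
      exact (mul_le_of_le_one_right (abs_nonneg _) (hb1 d)).trans ih
    have h3 := abs_sub_le (b (i * d + d)) (b (i * d) * b d) (b d ^ i * b d)
    rw [Nat.succ_mul, pow_succ]
    push_cast
    linarith

/-- The number `i` of factors is fixed while the block length `d` may grow without bound, which is
why the error must be uniform in `p, q`. -/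
theorem tendsto_apply_mul_sub_pow {b : ι → ℕ → ℝ} (h0 : ∀ x, b x 0 = 1)
    (hb0 : ∀ x n, 0 ≤ b x n) (hb1 : ∀ x n, b x n ≤ 1)
    (hb : ∀ ε > 0, ∀ᶠ x in l, ∀ p q, |b x (p + q) - b x p * b x q| ≤ ε) (d : ι → ℕ) (i : ℕ) :
    Tendsto (fun x => b x (i * d x) - b x (d x) ^ i) l (𝓝 0) := by
  rw [Metric.tendsto_nhds]
  intro ε hε
  filter_upwards [hb (ε / (i + 1)) (by positivity)] with x hx
  rw [Real.dist_0_eq_abs]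
  refine (abs_apply_mul_sub_pow_le (h0 x) (hb0 x) (hb1 x) hx (d x) i).trans_lt ?_
  rw [mul_div_assoc', div_lt_iff₀ (by positivity)]
  linarith

/-- An asymptotically multiplicative family behaves like an exponential along rational ratios. -/
theorem tendsto_apply_mul_of_tendsto {b : ι → ℕ → ℝ} (h0 : ∀ x, b x 0 = 1)
    (hb0 : ∀ x n, 0 ≤ b x n) (hb1 : ∀ x n, b x n ≤ 1)
    (hb : ∀ ε > 0, ∀ᶠ x in l, ∀ p q, |b x (p + q) - b x p * b x q| ≤ ε) {d : ι → ℕ} {i j : ℕ}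
    (hj : 0 < j) (h : Tendsto (fun x => b x (j * d x)) l (𝓝 (Real.exp (-1)))) :
    Tendsto (fun x => b x (i * d x)) l (𝓝 (Real.exp (-(i / j : ℝ)))) := by
  have h1 : Tendsto (fun x => b x (d x) ^ j) l (𝓝 (Real.exp (-1))) := by
    have := h.sub (tendsto_apply_mul_sub_pow h0 hb0 hb1 hb d j)
    simpa using this
  have h2 := (h1.rpow_const (p := (i / j : ℝ)) (Or.inl (Real.exp_pos _).ne')).add
    (tendsto_apply_mul_sub_pow h0 hb0 hb1 hb d i)
  have h3 : Real.exp (-1) ^ (i / j : ℝ) = Real.exp (-(i / j : ℝ)) := by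
    rw [← Real.exp_mul]
    ring_nf
  rw [add_zero, h3] at h2
  refine h2.congr fun x => ?_
  have hj' : (j : ℝ) ≠ 0 := by positivity
  rw [← Real.rpow_natCast (b x (d x)) j, ← Real.rpow_mul (hb0 x _), mul_div_cancel₀ _ hj',
    Real.rpow_natCast]
  ring

end ApproxMultiplicative

/-! ### From convergence at special levels to all levels. -/

section Polya

/-- If `a n (u n)` and `b n (u n)` had different limits, a level at which the monotone functions
`a n` and `b n` have a common limit strictly in between would separate them. -/
theorem le_of_tendsto_of_common_limits {l : Filter ℕ} [NeBot l] {a b : ℕ → ℝ → ℝ}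
    (ha : ∀ n, Monotone (a n)) (hb : ∀ n, Monotone (b n))
    (h : ∀ s : ℚ, 0 < s → ∃ x : ℕ → ℝ, Tendsto (fun n => a n (x n)) l (𝓝 (Real.exp (-s))) ∧
      Tendsto (fun n => b n (x n)) l (𝓝 (Real.exp (-s))))
    {u : ℕ → ℝ} {p q : ℝ} (hp : Tendsto (fun n => a n (u n)) l (𝓝 p))
    (hq : Tendsto (fun n => b n (u n)) l (𝓝 q)) (hp0 : 0 ≤ p) (hq1 : q ≤ 1) : q ≤ p := by
  by_contra! hpq
  have hm : 0 < (p + q) / 2 := by linarith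
  -- `e^{-s}` is placed between the midpoint and `q` rather than between `p` and `q`, because `p`
  -- may be `0`.
  obtain ⟨s, hs1, hs2⟩ := exists_rat_btwn
    (neg_lt_neg (Real.log_lt_log hm (show (p + q) / 2 < q by linarith)))
  have hq0 : 0 < q := by linarith
  have hs0 : (0 : ℝ) < s := by
    have := Real.log_nonpos hq0.le hq1
    linarith
  have e1 : Real.exp (-s) < q := by
    rw [← Real.lt_log_iff_exp_lt hq0]
    linarith
  have e2 : p < Real.exp (-s) := by
    have : (p + q) / 2 < Real.exp (-s) := by
      rw [← Real.log_lt_iff_lt_exp hm]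
      linarith
    linarith
  obtain ⟨x, hx1, hx2⟩ := h s (by exact_mod_cast hs0)
  refine absurd (le_of_tendsto_of_tendsto hq hx2 ?_) (not_le.2 e1)
  filter_upwards [hp.eventually_lt hx1 e2] with n hn
  exact hb n ((ha n).reflect_lt hn).le

/-- Along an ultrafilter both bounded sequences converge by compactness; the hypotheses are
symmetric in `a` and `b`, so each limit is at most the other. -/
theorem tendsto_sub_of_common_limits {a b : ℕ → ℝ → ℝ}
    (ha : ∀ n, Monotone (a n)) (hb : ∀ n, Monotone (b n))
    (ha' : ∀ n x, a n x ∈ Set.Icc (0 : ℝ) 1) (hb' : ∀ n x, b n x ∈ Set.Icc (0 : ℝ) 1)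
    (h : ∀ s : ℚ, 0 < s → ∃ x : ℕ → ℝ, Tendsto (fun n => a n (x n)) atTop (𝓝 (Real.exp (-s))) ∧
      Tendsto (fun n => b n (x n)) atTop (𝓝 (Real.exp (-s)))) (u : ℕ → ℝ) :
    Tendsto (fun n => a n (u n) - b n (u n)) atTop (𝓝 0) := by
  rw [tendsto_iff_ultrafilter]
  intro g hg
  have hlim : ∀ f : ℕ → ℝ, (∀ n, f n ∈ Set.Icc (0 : ℝ) 1) →
      ∃ p ∈ Set.Icc (0 : ℝ) 1, Tendsto f g (𝓝 p) := fun f hf =>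
    isCompact_Icc.ultrafilter_le_nhds (g.map f)
      (le_principal_iff.2 (mem_map.2 (univ_mem' hf)))
  obtain ⟨p, hp, hp'⟩ := hlim _ fun n => ha' n (u n)
  obtain ⟨q, hq, hq'⟩ := hlim _ fun n => hb' n (u n)
  have h' : ∀ s : ℚ, 0 < s → ∃ x : ℕ → ℝ, Tendsto (fun n => a n (x n)) g (𝓝 (Real.exp (-s))) ∧
      Tendsto (fun n => b n (x n)) g (𝓝 (Real.exp (-s))) := fun s hs => by
    obtain ⟨x, h1, h2⟩ := h s hs
    exact ⟨x, h1.mono_left hg, h2.mono_left hg⟩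
  have h1 := le_of_tendsto_of_common_limits ha hb h' hp' hq' hp.1 hq.2
  have h2 := le_of_tendsto_of_common_limits hb ha
    (fun s hs => (h' s hs).imp fun _ => And.symm) hq' hp' hq.1 hp.2
  have := hp'.sub hq'
  rwa [le_antisymm h2 h1, sub_self] at this

end Polya

/-! ### A continuous distribution function adapted to given levels. -/

section Construction

/-- The values `exp (-1/n)` prescribed at the `n`-th level, with `0` for `n = 0`. -/
noncomputable def expNegInv (n : ℕ) : ℝ := if n = 0 then 0 else Real.exp (-(1 / n : ℝ))

theorem expNegInv_mono : Monotone expNegInv := by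
  intro m n hmn
  unfold expNegInv
  rcases Nat.eq_zero_or_pos m with rfl | hm
  · rw [if_pos rfl]
    split_ifs <;> positivity
  · rw [if_neg hm.ne', if_neg (hm.trans_le hmn).ne', Real.exp_le_exp, neg_le_neg_iff]
    exact one_div_le_one_div_of_le (by exact_mod_cast hm) (by exact_mod_cast hmn)

theorem tendsto_expNegInv : Tendsto expNegInv atTop (𝓝 1) := by
  have h : Tendsto (fun n : ℕ => Real.exp (-(1 / n : ℝ))) atTop (𝓝 (Real.exp (-0))) :=
    (Real.continuous_exp.tendsto _).comp tendsto_one_div_atTop_nhds_zero_nat.neg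
  rw [neg_zero, Real.exp_zero] at h
  refine h.congr' ?_
  filter_upwards [eventually_gt_atTop 0] with n hn
  rw [expNegInv, if_neg hn.ne']

theorem expNegInv_pow {n : ℕ} (hn : 0 < n) (k : ℕ) :
    expNegInv n ^ k = Real.exp (-(k / n : ℝ)) := by
  rw [expNegInv, if_neg hn.ne', ← Real.exp_nat_mul]
  ring_nf

theorem continuous_cdf_of_noAtoms (ν : Measure ℝ) [IsProbabilityMeasure ν] [NullSingletonClass ν] :
    Continuous (cdf ν) := by
  rw [continuous_iff_continuousAt]
  intro x
  refine (monotone_cdf ν).continuousAt_iff_leftLim_eq_rightLim.2 ?_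
  rw [StieltjesFunction.rightLim_eq]
  have h := (cdf ν).measure_singleton x
  rw [measure_cdf, measure_singleton] at h
  have h1 := ENNReal.ofReal_eq_zero.1 h.symm
  exact le_antisymm ((monotone_cdf ν).leftLim_le le_rfl) (by linarith)

/-- The uniform law on a bounded interval `(w, v]` of positive length. -/
theorem exists_noAtoms_Ioc {w v : ℝ} (h : w < v) :
    ∃ U : Measure ℝ, IsProbabilityMeasure U ∧ NullSingletonClass U ∧ U (Set.Iic w) = 0 ∧
      U (Set.Iic v) = 1 := by
  have hp : IsProbabilityMeasure (cond volume (Set.Ioc w v)) :=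
    cond_isProbabilityMeasure_of_finite (by simp [h]) (by simp)
  refine ⟨cond volume (Set.Ioc w v), hp, ⟨fun x => ?_⟩, ?_, ?_⟩
  · exact cond_absolutelyContinuous (measure_singleton x)
  · rw [cond_apply measurableSet_Ioc]
    have : Set.Ioc w v ∩ Set.Iic w = ∅ := by
      ext x
      simp only [Set.mem_inter_iff, Set.mem_Ioc, Set.mem_Iic, Set.mem_empty_iff_false, iff_false]
      rintro ⟨⟨h1, _⟩, h2⟩
      linarith
    rw [this, measure_empty, mul_zero]
  · rw [cond_apply measurableSet_Ioc, Set.inter_eq_left.2 Set.Ioc_subset_Iic_self]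
    exact ENNReal.inv_mul_cancel (by simp [h]) (by simp)

/-- Spreading the increments of `expNegInv` over the gaps of a monotone sequence of levels gives a
continuous distribution function. -/
theorem exists_continuous_cdf_interpolating {v : ℕ → ℝ} (hv : Monotone v) :
    ∃ ν : Measure ℝ, IsProbabilityMeasure ν ∧ Continuous (cdf ν) ∧
      (∀ k, expNegInv k ≤ cdf ν (v k)) ∧ ∀ k N, v k < v N → cdf ν (v k) ≤ expNegInv N := by
  -- By monotonicity only the finitely many indices `k < m` matter. Levels may coincide, so the gap
  -- is taken below `v m` down to the next distinct level.
  have hw : ∀ m, ∃ w < v m, ∀ k, v k < v m → v k ≤ w := by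
    intro m
    have h1 : ∀ᶠ w in 𝓝[<] v m, ∀ k ∈ Finset.range m, v k < v m → v k ≤ w := by
      rw [Filter.eventually_all_finset]
      intro k _
      by_cases hk : v k < v m
      · filter_upwards [mem_nhdsWithin_of_mem_nhds (Ioi_mem_nhds hk)] with w hw _
        exact le_of_lt hw
      · exact Eventually.of_forall fun w h => absurd h hk
    obtain ⟨w, hw, hwm⟩ := (h1.and self_mem_nhdsWithin).exists
    exact ⟨w, hwm, fun k hk => hw k (Finset.mem_range.2 (hv.reflect_lt hk)) hk⟩
  choose w hwv hw using hw
  choose U hU1 hU2 hU3 hU4 using fun m => exists_noAtoms_Ioc (hwv m)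
  set c : ℕ → ℝ := fun m => expNegInv (m + 1) - expNegInv m with hc
  have hc0 : ∀ m, 0 ≤ c m := fun m => sub_nonneg.2 (expNegInv_mono (Nat.le_succ m))
  have hcs : ∀ n, ∑ m ∈ Finset.range n, c m = expNegInv n := fun n => by
    rw [hc, Finset.sum_range_sub, show expNegInv 0 = 0 from if_pos rfl, sub_zero]
  have hsum : HasSum c 1 := by
    rw [hasSum_iff_tendsto_nat_of_nonneg hc0]
    simpa only [hcs] using tendsto_expNegInv
  have hpart : ∀ n, ∑ m ∈ Finset.range n, ENNReal.ofReal (c m) =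
      ENNReal.ofReal (expNegInv n) := fun n => by
    rw [← ENNReal.ofReal_sum_of_nonneg fun m _ => hc0 m, hcs]
  -- The increment from `m` to `m + 1` is spread over the gap just below `v (m + 1)`; the masses
  -- telescope to `1`.
  set ν : Measure ℝ := Measure.sum fun m => ENNReal.ofReal (c m) • U (m + 1) with hν
  have hνapply : ∀ s, MeasurableSet s → ν s = ∑' m, ENNReal.ofReal (c m) * U (m + 1) s :=
    fun s hs => by
      rw [hν, Measure.sum_apply _ hs]
      rfl
  have hν1 : IsProbabilityMeasure ν := ⟨by
    rw [hνapply _ MeasurableSet.univ]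
    simp only [measure_univ, mul_one]
    rw [← ENNReal.ofReal_tsum_of_nonneg hc0 hsum.summable, hsum.tsum_eq, ENNReal.ofReal_one]⟩
  have hν2 : NullSingletonClass ν := ⟨fun x => by
    rw [hνapply _ (measurableSet_singleton x)]
    simp⟩
  refine ⟨ν, hν1, continuous_cdf_of_noAtoms ν, fun k => ?_, fun k N hkN => ?_⟩
  · rw [cdf_eq_real, measureReal_def, ← ENNReal.ofReal_le_iff_le_toReal (measure_ne_top _ _),
      hνapply _ measurableSet_Iic, ← hpart]
    refine le_trans (Finset.sum_le_sum fun m hm => ?_) (ENNReal.sum_le_tsum (Finset.range k))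
    have : 1 ≤ U (m + 1) (Set.Iic (v k)) := by
      rw [← hU4 (m + 1)]
      exact measure_mono (Set.Iic_subset_Iic.2 (hv (Finset.mem_range.1 hm)))
    exact le_mul_of_one_le_right' this
  · rw [cdf_eq_real, measureReal_def]
    refine ENNReal.toReal_le_of_le_ofReal ?_ ?_
    · rw [expNegInv]
      split_ifs <;> positivity
    rw [hνapply _ measurableSet_Iic, tsum_eq_sum (s := Finset.range N), ← hpart]
    · exact Finset.sum_le_sum fun m _ => mul_le_of_le_one_right' prob_le_one
    · intro m hm
      have hNm : N ≤ m + 1 := by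
        rw [Finset.mem_range] at hm
        omega
      have : U (m + 1) (Set.Iic (v k)) = 0 := measure_mono_null
        (Set.Iic_subset_Iic.2 (hw (m + 1) k (hkN.trans_le (hv hNm)))) (hU3 (m + 1))
      rw [this, mul_zero]

/-- The lower bound is immediate from `exp(-1/k)^k = e⁻¹`. For the upper bound take `N = (j + 1) (k
/ j + 1) ≈ (1 + 1/j) k`: since `v k < v N`, the power is at most `exp(-k/N)`, with limit
`exp(-j/(j+1))`; then `j` is taken large. -/
theorem exists_continuous_cdf_pow_tendsto {v : ℕ → ℝ} (hv : Monotone v)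
    (h : ∀ j : ℕ, 0 < j → ∀ᶠ k in atTop, v k < v ((j + 1) * (k / j + 1))) :
    ∃ ν : Measure ℝ, IsProbabilityMeasure ν ∧ Continuous (cdf ν) ∧
      Tendsto (fun k => cdf ν (v k) ^ k) atTop (𝓝 (Real.exp (-1))) := by
  obtain ⟨ν, hν, hcont, hlow, hup⟩ := exists_continuous_cdf_interpolating hv
  refine ⟨ν, hν, hcont, tendsto_order.2 ⟨fun y hy => ?_, fun y hy => ?_⟩⟩
  · filter_upwards [eventually_gt_atTop 0] with k hk
    refine hy.trans_le ?_
    have h1 : expNegInv k ^ k ≤ cdf ν (v k) ^ k := by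
      refine pow_le_pow_left₀ ?_ (hlow k) k
      rw [expNegInv]
      split_ifs <;> positivity
    rwa [expNegInv_pow hk, div_self (by positivity)] at h1
  · have h1 : Tendsto (fun j : ℕ => Real.exp (-(j / (j + 1) : ℝ))) atTop (𝓝 (Real.exp (-1))) :=
      (Real.continuous_exp.tendsto _).comp (tendsto_natCast_div_add_atTop (1 : ℝ)).neg
    obtain ⟨j, hjy, hj⟩ := ((h1.eventually (gt_mem_nhds hy)).and (eventually_gt_atTop 0)).exists
    have h2 : Tendsto (fun k : ℕ => Real.exp (-((j / (j + 1)) * (k / (k + j)) : ℝ))) atTop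
        (𝓝 (Real.exp (-((j / (j + 1)) * 1 : ℝ)))) :=
      (Real.continuous_exp.tendsto _).comp
        ((tendsto_natCast_div_add_atTop (j : ℝ)).const_mul _).neg
    rw [mul_one] at h2
    filter_upwards [h j hj, h2.eventually (gt_mem_nhds hjy)] with k hk hk2
    refine lt_of_le_of_lt ?_ hk2
    have hN : 0 < (j + 1) * (k / j + 1) := by positivity
    refine (pow_le_pow_left₀ (cdf_nonneg _ _) (hup k _ hk) k).trans ?_
    rw [expNegInv_pow hN, Real.exp_le_exp, neg_le_neg_iff, div_mul_div_comm]
    have hj' : (0 : ℝ) < j := by exact_mod_cast hj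
    have hd : ((k / j : ℕ) : ℝ) * j ≤ k := by exact_mod_cast Nat.div_mul_le_self k j
    rw [div_le_div_iff₀ (by positivity) (by positivity)]
    push_cast
    have : (j : ℝ) * ((j + 1) * ((k / j : ℕ) + 1)) ≤ (j + 1) * (k + j) := by nlinarith
    calc (j : ℝ) * k * ((j + 1) * ((k / j : ℕ) + 1))
        = k * (j * ((j + 1) * ((k / j : ℕ) + 1))) := by ring
      _ ≤ k * ((j + 1) * (k + j)) := by gcongr

end Construction

/-! ### A criterion in terms of levels. -/

section Criterion

theorem tendsto_div_mul_div {i j : ℕ} (hi : 0 < i) (hj : 0 < j) :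
    Tendsto (fun n : ℕ => (n : ℝ) / ((j * (n / i) : ℕ) : ℝ)) atTop (𝓝 (i / j : ℝ)) := by
  have hd : Tendsto (fun n : ℕ => n / i) atTop atTop := Nat.tendsto_div_const_atTop hi.ne'
  have hd' : Tendsto (fun n : ℕ => ((n / i : ℕ) : ℝ)) atTop atTop :=
    tendsto_natCast_atTop_atTop.comp hd
  have h2 : Tendsto (fun n : ℕ => (i / j : ℝ) + (i / j : ℝ) * (((n / i : ℕ) : ℝ))⁻¹) atTop
      (𝓝 ((i / j : ℝ) + (i / j : ℝ) * 0)) :=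
    (hd'.inv_tendsto_atTop.const_mul _).const_add _
  rw [mul_zero, add_zero] at h2
  have hj' : (0 : ℝ) < j := by exact_mod_cast hj
  refine tendsto_of_tendsto_of_tendsto_of_le_of_le' tendsto_const_nhds h2 ?_ ?_
  · filter_upwards [hd.eventually (eventually_gt_atTop 0)] with n hn
    have hn' : (0 : ℝ) < (n / i : ℕ) := by exact_mod_cast hn
    have : ((n / i : ℕ) : ℝ) * i ≤ n := by exact_mod_cast Nat.div_mul_le_self n i
    push_cast
    rw [div_le_div_iff₀ hj' (by positivity)]
    nlinarith
  · filter_upwards [hd.eventually (eventually_gt_atTop 0)] with n hn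
    have hn' : (0 : ℝ) < (n / i : ℕ) := by exact_mod_cast hn
    have : (n : ℝ) ≤ (n / i : ℕ) * i + i := by
      have h1 := Nat.div_add_mod n i
      have h2 := Nat.mod_lt n hi
      have h3 : n ≤ n / i * i + i := by rw [mul_comm]; omega
      exact_mod_cast h3
    push_cast
    have e : (i / j : ℝ) + (i / j : ℝ) * (((n / i : ℕ) : ℝ))⁻¹ =
        ((n / i : ℕ) * i + i) / (j * (n / i : ℕ)) := by
      field_simp
    rw [e]
    gcongr

variable {Ω : Type*} [MeasurableSpace Ω] {μ : Measure Ω} {X : ℕ → Ω → ℝ}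
  [IsProbabilityMeasure μ]

/-- Asymptotic multiplicativity of the distribution functions of the maxima at high levels. -/
theorem eventually_abs_maxDF_add_sub_mul_le (hstat : StrictlyStationary μ X)
    (hX : ∀ j, Measurable (X j)) (hmix : IsAlphaMixing μ X) {ι : Type*} {l : Filter ι}
    {y : ι → ℝ} (hy : Tendsto (fun t => marginalDF μ X (y t)) l (𝓝 1)) {ε : ℝ} (hε : 0 < ε) :
    ∀ᶠ t in l, ∀ p q,
      |maxDF μ X (p + q) (y t) - maxDF μ X p (y t) * maxDF μ X q (y t)| ≤ ε := by
  -- The gap `r` is fixed first; only then is the level raised until `2 r (1 - F)` is negligible.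
  obtain ⟨r, hr⟩ := (hmix.eventually (gt_mem_nhds hε)).exists
  have h : Tendsto (fun t => alphaCoeff μ X r + 2 * r * (1 - marginalDF μ X (y t))) l
      (𝓝 (alphaCoeff μ X r + 2 * r * (1 - 1))) := ((hy.const_sub _).const_mul _).const_add _
  rw [sub_self, mul_zero, add_zero] at h
  filter_upwards [h.eventually (gt_mem_nhds hr)] with t ht p q
  exact (abs_maxDF_add_sub_mul_le hstat hX (y t) p q r).trans ht.le

/-- This absorbs the remainders of integer division in block sizes. -/
theorem tendsto_maxDF_sub_of_bounded (hstat : StrictlyStationary μ X)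
    (hX : ∀ j, Measurable (X j)) {ι : Type*} {l : Filter ι} {y : ι → ℝ}
    (hy : Tendsto (fun t => marginalDF μ X (y t)) l (𝓝 1)) {m n : ι → ℕ} {J : ℕ}
    (h1 : ∀ t, m t ≤ n t + J) (h2 : ∀ t, n t ≤ m t + J) :
    Tendsto (fun t => maxDF μ X (m t) (y t) - maxDF μ X (n t) (y t)) l (𝓝 0) := by
  have h : Tendsto (fun t => J * (1 - marginalDF μ X (y t))) l (𝓝 (J * (1 - 1))) :=
    (hy.const_sub _).const_mul _
  rw [sub_self, mul_zero] at h
  refine squeeze_zero_norm (fun t => ?_) h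
  exact abs_maxDF_sub_le hstat hX (y t) (h1 t) (h2 t)

/-- The distribution functions of maxima of size `n ≈ (i / j) k` at the `k`-th level. -/
theorem tendsto_maxDF_of_ratio (hstat : StrictlyStationary μ X)
    (hX : ∀ j, Measurable (X j)) (hmix : IsAlphaMixing μ X) {v : ℕ → ℝ}
    (hF : Tendsto (fun k => marginalDF μ X (v k)) atTop (𝓝 1))
    (hv : Tendsto (fun k => maxDF μ X k (v k)) atTop (𝓝 (Real.exp (-1)))) {k d n : ℕ → ℕ}
    {i j J : ℕ} (hj : 0 < j) (hk : Tendsto k atTop atTop) (h1 : ∀ t, j * d t ≤ k t + J)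
    (h2 : ∀ t, k t ≤ j * d t + J) (h3 : ∀ t, n t ≤ i * d t + J) (h4 : ∀ t, i * d t ≤ n t + J) :
    Tendsto (fun t => maxDF μ X (n t) (v (k t))) atTop (𝓝 (Real.exp (-(i / j : ℝ)))) := by
  have hF' := hF.comp hk
  have a1 := (tendsto_maxDF_sub_of_bounded hstat hX hF' h1 h2).add (hv.comp hk)
  have a2 : Tendsto (fun t => maxDF μ X (j * d t) (v (k t))) atTop (𝓝 (Real.exp (-1))) := by
    simpa using a1
  have a3 := tendsto_apply_mul_of_tendsto (b := fun t p => maxDF μ X p (v (k t))) (i := i)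
    (fun t => maxDF_zero _) (fun t p => maxDF_nonneg p _) (fun t p => maxDF_le_one p _)
    (fun ε hε => eventually_abs_maxDF_add_sub_mul_le hstat hX hmix hF' hε) hj a2
  have a4 := (tendsto_maxDF_sub_of_bounded hstat hX hF' h3 h4).add a3
  simpa using a4

/-- A mixing stationary sequence with suitable levels has a continuous phantom distribution
function. -/
theorem admitsContinuousPhantomDF_of_levels (hstat : StrictlyStationary μ X)
    (hX : ∀ j, Measurable (X j)) (hmix : IsAlphaMixing μ X) {v : ℕ → ℝ} (hmono : Monotone v)
    (hF : Tendsto (fun k => marginalDF μ X (v k)) atTop (𝓝 1))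
    (hlow : ∀ k, 1 ≤ k → Real.exp (-1) ≤ maxDF μ X k (v k))
    (hv : Tendsto (fun k => maxDF μ X k (v k)) atTop (𝓝 (Real.exp (-1)))) :
    AdmitsContinuousPhantomDF μ X := by
  -- With `N ≈ (1 + 1/j) k`, `b_N(v_k)` tends to `exp(-(1 + 1/j)) < e⁻¹ ≤ b_N(v_N)`, which forces
  -- `v_k < v_N`.
  have hgap : ∀ j : ℕ, 0 < j → ∀ᶠ k in atTop, v k < v ((j + 1) * (k / j + 1)) := by
    intro j hj
    have h := tendsto_maxDF_of_ratio hstat hX hmix hF hv (k := id) (d := fun k => k / j + 1)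
      (n := fun k => (j + 1) * (k / j + 1)) (i := j + 1) (J := j) hj tendsto_id
      (fun t => by have := Nat.mul_div_le t j; simp only [id]; linarith)
      (fun t => by
        have h1 := Nat.div_add_mod t j
        have h2 := Nat.mod_lt t hj
        simp only [id]
        linarith) (fun t => Nat.le_add_right _ _) (fun t => Nat.le_add_right _ _)
    have hlt : Real.exp (-((j + 1 : ℕ) / j : ℝ)) < Real.exp (-1) := by
      have hj' : (0 : ℝ) < j := by exact_mod_cast hj
      rw [Real.exp_lt_exp, neg_lt_neg_iff, lt_div_iff₀ hj']
      push_cast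
      linarith
    filter_upwards [h.eventually (gt_mem_nhds hlt)] with k hk
    exact (maxDF_mono _).reflect_lt (hk.trans_le (hlow _ (by nlinarith [Nat.zero_le (k / j)])))
  obtain ⟨ν, hν, hcont, hG⟩ := exists_continuous_cdf_pow_tendsto hmono hgap
  refine ⟨ν, hν, hcont, fun u => ?_⟩
  have key := tendsto_sub_of_common_limits (a := fun n => maxDF μ X n)
    (b := fun n x => cdf ν x ^ n) (fun n => maxDF_mono n)
    (fun n x y hxy => pow_le_pow_left₀ (cdf_nonneg _ _) (monotone_cdf ν hxy) n)
    (fun n x => ⟨maxDF_nonneg n x, maxDF_le_one n x⟩)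
    (fun n x => ⟨pow_nonneg (cdf_nonneg _ _) n, pow_le_one₀ (cdf_nonneg _ _) (cdf_le_one _ _)⟩)
    ?_ u
  · refine key.congr' ?_
    -- At `n = 0` the supremum over the empty type is `0`, so the two descriptions of the maximum
    -- may differ.
    filter_upwards [eventually_gt_atTop 0] with n hn
    rw [real_partialMax_le hn]
  intro s hs
  obtain ⟨i, j, hi, hj, hij⟩ : ∃ i j : ℕ, 0 < i ∧ 0 < j ∧ (s : ℝ) = i / j := by
    have hnum : 0 < s.num := Rat.num_pos.2 hs
    refine ⟨s.num.toNat, s.den, by omega, s.den_pos, ?_⟩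
    rw [Rat.cast_def]
    congr 1
    exact_mod_cast (Int.toNat_of_nonneg hnum.le).symm
  have hk : Tendsto (fun n => j * (n / i)) atTop atTop :=
    (Nat.tendsto_div_const_atTop hi.ne').const_mul_atTop' hj
  -- For `s = i/j` the level index is about `n/s`, so `n` is about `s` times the size for which the
  -- limit is `e⁻¹`.
  refine ⟨fun n => v (j * (n / i)), ?_, ?_⟩
  · rw [hij]
    refine tendsto_maxDF_of_ratio hstat hX hmix hF hv (d := fun n => n / i) (J := i) hj hk
      (fun t => Nat.le_add_right _ _) (fun t => Nat.le_add_right _ _) (fun t => ?_) (fun t => ?_)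
    · have h1 := Nat.div_add_mod t i
      have h2 := Nat.mod_lt t hi
      omega
    · have := Nat.mul_div_le t i
      omega
  · have h1 := (hG.comp hk).rpow (tendsto_div_mul_div hi hj) (Or.inl (Real.exp_pos _).ne')
    have h2 : Real.exp (-1) ^ (i / j : ℝ) = Real.exp (-s) := by
      rw [← Real.exp_mul, hij]
      ring_nf
    rw [h2] at h1
    refine h1.congr' ?_
    filter_upwards [hk.eventually (eventually_gt_atTop 0)] with n hn
    have hn' : ((j * (n / i) : ℕ) : ℝ) ≠ 0 := by exact_mod_cast hn.ne'
    simp only [Function.comp]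
    rw [← Real.rpow_natCast (cdf ν _) (j * (n / i)), ← Real.rpow_mul (cdf_nonneg _ _),
      mul_div_cancel₀ _ hn', Real.rpow_natCast]

end Criterion

/-! ### Jump conditions and the three mixing regimes. -/

section Main

variable {Ω : Type*} [MeasurableSpace Ω] {μ : Measure Ω} {X : ℕ → Ω → ℝ}

theorem jump_nonneg {F : ℝ → ℝ} (hF : Monotone F) (x : ℝ) : 0 ≤ jump F x :=
  sub_nonneg.2 (hF.leftLim_le le_rfl)

theorem tendsto_marginalDF_of_le {v g : ℕ → ℝ} (hg : Tendsto g atTop (𝓝 0))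
    (h : ∀ᶠ n in atTop, 1 - marginalDF μ X (v n) ≤ g n) :
    Tendsto (fun n => marginalDF μ X (v n)) atTop (𝓝 1) := by
  have h1 := hg.const_sub 1
  rw [sub_zero] at h1
  refine tendsto_of_tendsto_of_tendsto_of_le_of_le' h1 tendsto_const_nhds ?_
    (Eventually.of_forall fun n => marginalDF_le_one _)
  filter_upwards [h] with n hn
  linarith

/-- Levels below the right end at which `F` tends to `1` converge to the right end. -/
theorem tendsto_comap_rightEnd {F : ℝ → ℝ} (hmono : Monotone F) {v : ℕ → ℝ}
    (hv : ∀ n, (v n : EReal) < rightEnd F) (hF : Tendsto (fun n => F (v n)) atTop (𝓝 1)) :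
    Tendsto v atTop (comap (fun x : ℝ => (x : EReal)) (𝓝[<] rightEnd F)) := by
  rw [tendsto_comap_iff]
  refine tendsto_nhdsWithin_iff.2 ⟨tendsto_order.2 ⟨fun a ha => ?_, fun a ha => ?_⟩,
    Eventually.of_forall hv⟩
  · obtain ⟨_, ⟨y, hy, rfl⟩, hay⟩ := lt_sSup_iff.1 ha
    filter_upwards [hF.eventually (lt_mem_nhds hy)] with n hn
    exact hay.trans (EReal.coe_lt_coe_iff.2 (hmono.reflect_lt hn))
  · exact Eventually.of_forall fun n => (hv n).trans ha

variable [IsProbabilityMeasure μ]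

/-- The quantiles of the maxima are suitable levels as soon as the jumps there are `o(1/n)`. -/
theorem admitsContinuousPhantomDF_of_jump (hstat : StrictlyStationary μ X)
    (hX : ∀ j, Measurable (X j)) (hmix : IsAlphaMixing μ X)
    (hcont : ContinuousAtRightEnd (marginalDF μ X))
    (hF : Tendsto (fun n => marginalDF μ X (maxQuantile μ X n)) atTop (𝓝 1))
    (hJ : Tendsto (fun n : ℕ => n * jump (marginalDF μ X) (maxQuantile μ X n)) atTop (𝓝 0)) :
    AdmitsContinuousPhantomDF μ X := by
  refine admitsContinuousPhantomDF_of_levels hstat hX hmix (maxQuantile_mono hstat hX hcont) hF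
    (fun k hk => exp_le_maxDF_maxQuantile hstat hX hcont hk) ?_
  have h := hJ.const_add (Real.exp (-1))
  rw [add_zero] at h
  refine tendsto_of_tendsto_of_tendsto_of_le_of_le' tendsto_const_nhds h ?_ ?_
  · filter_upwards [eventually_ge_atTop 1] with n hn
    exact exp_le_maxDF_maxQuantile hstat hX hcont hn
  · filter_upwards [eventually_ge_atTop 1] with n hn
    exact maxDF_maxQuantile_le hstat hX hn

/-- Mesh `m + 1` has no mixing cost, so `1 - F(v_n) = O(1/n)` and `n ΔF(v_n)` is dominated by a
constant times `ΔF / (1 - F)`. -/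
theorem admitsContinuousPhantomDF_of_mDependent (hstat : StrictlyStationary μ X)
    (hX : ∀ j, Measurable (X j)) (hmix : IsAlphaMixing μ X)
    (hcont : ContinuousAtRightEnd (marginalDF μ X)) {m : ℕ} (hm : alphaCoeff μ X (m + 1) = 0)
    (hΔ : DeltaZero (marginalDF μ X)) : AdmitsContinuousPhantomDF μ X := by
  have hbound : ∀ n : ℕ, m + 1 ≤ n →
      n * (1 - marginalDF μ X (maxQuantile μ X n)) ≤ 4 * (m + 1) := by
    intro n hn
    have hk : 0 < n / (m + 1) := Nat.div_pos hn m.succ_pos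
    have h := mul_one_sub_marginalDF_maxQuantile_le hstat hX hcont (n := n) (r := m + 1)
      (k := n / (m + 1)) (by omega) m.succ_pos (Nat.div_mul_le_self _ _) (by
        rw [hm, mul_zero]
        positivity)
    have h1 : (n : ℝ) ≤ 2 * (m + 1) * (n / (m + 1) : ℕ) := by
      have h2 := Nat.div_add_mod n (m + 1)
      have h3 := Nat.mod_lt n m.succ_pos
      have h4 : n ≤ 2 * (m + 1) * (n / (m + 1)) := by nlinarith
      exact_mod_cast h4
    have h0 : 0 ≤ 1 - marginalDF μ X (maxQuantile μ X n) := sub_nonneg.2 (marginalDF_le_one _)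
    calc (n : ℝ) * (1 - marginalDF μ X (maxQuantile μ X n))
        ≤ 2 * (m + 1) * (n / (m + 1) : ℕ) * (1 - marginalDF μ X (maxQuantile μ X n)) := by gcongr
      _ = 2 * (m + 1) * ((n / (m + 1) : ℕ) * (1 - marginalDF μ X (maxQuantile μ X n))) := by ring
      _ ≤ 2 * (m + 1) * 2 := by gcongr
      _ = 4 * (m + 1) := by ring
  have hF : Tendsto (fun n => marginalDF μ X (maxQuantile μ X n)) atTop (𝓝 1) := by
    refine tendsto_marginalDF_of_le (tendsto_const_div_atTop_nhds_zero_nat (4 * (m + 1) : ℝ)) ?_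
    filter_upwards [eventually_ge_atTop (m + 1)] with n hn
    have hn' : (0 : ℝ) < n := by exact_mod_cast (by omega : 0 < n)
    rw [le_div_iff₀ hn', mul_comm]
    exact hbound n hn
  refine admitsContinuousPhantomDF_of_jump hstat hX hmix hcont hF ?_
  have hv := maxQuantile_lt_rightEnd hstat hX hcont
  have h1 := (hΔ.comp (tendsto_comap_rightEnd marginalDF_mono hv hF)).const_mul (4 * (m + 1) : ℝ)
  rw [mul_zero] at h1
  refine tendsto_of_tendsto_of_tendsto_of_le_of_le' tendsto_const_nhds h1
    (Eventually.of_forall fun n => mul_nonneg n.cast_nonneg (jump_nonneg marginalDF_mono _)) ?_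
  filter_upwards [eventually_ge_atTop (m + 1)] with n hn
  have hpos : 0 < 1 - marginalDF μ X (maxQuantile μ X n) :=
    sub_pos.2 (lt_one_of_lt_rightEnd marginalDF_mono (hv n))
  have hj := jump_nonneg (marginalDF_mono (μ := μ) (X := X)) (maxQuantile μ X n)
  simp only [Function.comp]
  rw [mul_div_assoc', le_div_iff₀ hpos]
  nlinarith [mul_le_mul_of_nonneg_right (hbound n hn) hj]

/-- A tail bound of the order `n ^ (-η)` at the quantiles suffices under `Δ_ξ` with
`η (1 + ξ) > 1`. -/
theorem admitsContinuousPhantomDF_of_tail_le (hstat : StrictlyStationary μ X)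
    (hX : ∀ j, Measurable (X j)) (hmix : IsAlphaMixing μ X)
    (hcont : ContinuousAtRightEnd (marginalDF μ X)) {ξ η K : ℝ} (hξ : 0 < ξ) (hη : 0 < η)
    (hK : 0 ≤ K) (hηξ : 1 < η * (1 + ξ))
    (htail : ∀ᶠ n : ℕ in atTop,
      1 - marginalDF μ X (maxQuantile μ X n) ≤ K * (n : ℝ) ^ (-η))
    (hΔ : DeltaXi (marginalDF μ X) ξ) : AdmitsContinuousPhantomDF μ X := by
  have hpow : ∀ {c : ℝ}, 0 < c → Tendsto (fun n : ℕ => (n : ℝ) ^ (-c)) atTop (𝓝 0) := fun hc =>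
    (tendsto_rpow_neg_atTop hc).comp tendsto_natCast_atTop_atTop
  have hF : Tendsto (fun n => marginalDF μ X (maxQuantile μ X n)) atTop (𝓝 1) := by
    have := (hpow hη).const_mul K
    rw [mul_zero] at this
    exact tendsto_marginalDF_of_le this htail
  refine admitsContinuousPhantomDF_of_jump hstat hX hmix hcont hF ?_
  obtain ⟨M, hM⟩ := hΔ
  have hv := maxQuantile_lt_rightEnd hstat hX hcont
  have h1 := (hpow (c := η * (1 + ξ) - 1) (by linarith)).const_mul (|M| * K ^ (1 + ξ))
  rw [mul_zero] at h1
  refine tendsto_of_tendsto_of_tendsto_of_le_of_le' tendsto_const_nhds h1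
    (Eventually.of_forall fun n => mul_nonneg n.cast_nonneg (jump_nonneg marginalDF_mono _)) ?_
  filter_upwards [htail, eventually_gt_atTop 0] with n hn hn0
  have hn' : (0 : ℝ) < n := by exact_mod_cast hn0
  have hpos : 0 < 1 - marginalDF μ X (maxQuantile μ X n) :=
    sub_pos.2 (lt_one_of_lt_rightEnd marginalDF_mono (hv n))
  have h2 := hM _ (hv n)
  rw [div_le_iff₀ (Real.rpow_pos_of_pos hpos _)] at h2
  calc (n : ℝ) * jump (marginalDF μ X) (maxQuantile μ X n)
      ≤ n * (|M| * (K * (n : ℝ) ^ (-η)) ^ (1 + ξ)) := by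
        gcongr
        refine h2.trans ?_
        gcongr
        exact le_abs_self M
    _ = |M| * K ^ (1 + ξ) * (n : ℝ) ^ (-(η * (1 + ξ) - 1)) := by
        rw [Real.mul_rpow hK (by positivity), ← Real.rpow_mul hn'.le,
          show -(η * (1 + ξ) - 1) = 1 + -η * (1 + ξ) by ring, Real.rpow_add hn', Real.rpow_one]
        ring

/-- Take mesh `r ≈ n^δ` and `k ≈ n^{1-δ}`. Then `k α(r) → 0` needs `δ (1 + β) > 1`, while `n ΔF(v_n)
→ 0` needs `(1 - δ)(1 + ξ) > 1`, that is `δ < ξ / (1 + ξ)`. Such a `δ` exists exactly when `ξ β >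
1`. -/
theorem admitsContinuousPhantomDF_of_polynomial (hstat : StrictlyStationary μ X)
    (hX : ∀ j, Measurable (X j)) (hmix : IsAlphaMixing μ X)
    (hcont : ContinuousAtRightEnd (marginalDF μ X)) {C β ξ : ℝ} (hC : 0 < C) (hβ : 0 < β)
    (hα : ∀ n : ℕ, 1 ≤ n → alphaCoeff μ X n ≤ C * (n : ℝ) ^ (-β)) (hξ : 1 / β < ξ)
    (hΔ : DeltaXi (marginalDF μ X) ξ) : AdmitsContinuousPhantomDF μ X := by
  have hξ0 : 0 < ξ := (one_div_pos.2 hβ).trans hξ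
  rw [div_lt_iff₀ hβ] at hξ
  obtain ⟨δ, hδ1, hδ2⟩ : ∃ δ, 1 / (1 + β) < δ ∧ δ < ξ / (1 + ξ) := by
    refine exists_between ?_
    rw [div_lt_div_iff₀ (by linarith) (by linarith)]
    linarith
  have hδ0 : 0 < δ := lt_trans (by positivity) hδ1
  rw [div_lt_iff₀ (by linarith)] at hδ1
  rw [lt_div_iff₀ (by linarith)] at hδ2
  have hδlt : δ < 1 := by
    by_contra! h
    nlinarith
  refine admitsContinuousPhantomDF_of_tail_le hstat hX hmix hcont hξ0 (η := 1 - δ) (K := 8)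
    (by linarith) (by norm_num) (by linarith) ?_ hΔ
  have hlim : Tendsto (fun n : ℕ => C * (n : ℝ) ^ (-(δ * (1 + β) - 1))) atTop (𝓝 (C * 0)) :=
    ((tendsto_rpow_neg_atTop (by linarith)).comp tendsto_natCast_atTop_atTop).const_mul C
  rw [mul_zero] at hlim
  have hlim2 : Tendsto (fun n : ℕ => (n : ℝ) ^ (1 - δ)) atTop atTop :=
    (tendsto_rpow_atTop (by linarith)).comp tendsto_natCast_atTop_atTop
  filter_upwards [hlim.eventually (gt_mem_nhds (show 0 < Real.exp (-1) / 2 by positivity)),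
    hlim2.eventually (eventually_ge_atTop 4), eventually_ge_atTop 1] with n hn1 hn2 hn
  have hn' : (1 : ℝ) ≤ n := by exact_mod_cast hn
  have hn0 : (0 : ℝ) < n := by linarith
  set R : ℝ := (n : ℝ) ^ δ with hR
  have hR1 : 1 ≤ R := Real.one_le_rpow hn' hδ0.le
  set r : ℕ := ⌈R⌉₊ with hr
  have hRr : R ≤ r := Nat.le_ceil R
  have hrR : (r : ℝ) ≤ 2 * R := by
    have := Nat.ceil_lt_add_one (show 0 ≤ R by linarith)
    linarith
  have hr0 : 0 < r := by
    have : (0 : ℝ) < r := by linarith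
    exact_mod_cast this
  have hr0' : (0 : ℝ) < r := by exact_mod_cast hr0
  have hmulR : R * (n : ℝ) ^ (1 - δ) = n := by
    rw [hR, ← Real.rpow_add hn0]
    norm_num
  have hkle : ((n / r : ℕ) : ℝ) ≤ (n : ℝ) ^ (1 - δ) := by
    refine Nat.cast_div_le.trans ?_
    rw [div_le_iff₀ hr0']
    calc (n : ℝ) = (n : ℝ) ^ (1 - δ) * R := by rw [mul_comm, hmulR]
      _ ≤ (n : ℝ) ^ (1 - δ) * r := by gcongr
  -- Rounding `r` up costs a factor `2`, and rounding `n / r` down another since `n^{1-δ} ≥ 4`; with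
  -- the tail bound `2` this gives `K = 8`.
  have hkge : (n : ℝ) ^ (1 - δ) / 4 ≤ (n / r : ℕ) := by
    have h1 : (n : ℝ) ≤ ((n / r : ℕ) + 1) * r := by
      have h2 := Nat.div_add_mod n r
      have h3 := Nat.mod_lt n hr0
      have h4 : n ≤ (n / r + 1) * r := by nlinarith
      exact_mod_cast h4
    have h2 : R * (n : ℝ) ^ (1 - δ) ≤ R * (2 * ((n / r : ℕ) + 1)) := by
      rw [hmulR]
      refine h1.trans ?_
      have : (((n / r : ℕ) : ℝ) + 1) * r ≤ ((n / r : ℕ) + 1) * (2 * R) := by gcongr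
      linarith
    have h3 := le_of_mul_le_mul_left h2 (by linarith)
    linarith
  have hαr : ((n / r : ℕ) : ℝ) * alphaCoeff μ X r ≤ Real.exp (-1) / 2 := by
    have h1 : alphaCoeff μ X r ≤ C * R ^ (-β) := by
      refine (hα r hr0).trans ?_
      gcongr ?_ * ?_
      exact Real.rpow_le_rpow_of_nonpos (by linarith) hRr (by linarith)
    calc ((n / r : ℕ) : ℝ) * alphaCoeff μ X r ≤ (n : ℝ) ^ (1 - δ) * (C * R ^ (-β)) :=
          mul_le_mul hkle h1 (alphaCoeff_nonneg r) (by positivity)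
      _ = C * (n : ℝ) ^ (-(δ * (1 + β) - 1)) := by
          rw [hR, ← Real.rpow_mul hn0.le,
            show -(δ * (1 + β) - 1) = (1 - δ) + δ * -β by ring, Real.rpow_add hn0]
          ring
      _ ≤ _ := hn1.le
  have h := mul_one_sub_marginalDF_maxQuantile_le hstat hX hcont hn hr0
    (Nat.div_mul_le_self n r) hαr
  have h0 : 0 ≤ 1 - marginalDF μ X (maxQuantile μ X n) := sub_nonneg.2 (marginalDF_le_one _)
  have h1 := (mul_le_mul_of_nonneg_right hkge h0).trans h
  rw [Real.rpow_neg hn0.le, ← div_eq_mul_inv, le_div_iff₀ (by positivity)]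
  linarith

/-- Geometric decay is faster than any power. -/
theorem exists_geometric_le_rpow {C ρ β : ℝ} (hC : 0 < C) (hρ0 : 0 ≤ ρ) (hρ1 : ρ < 1) :
    ∃ C', 0 < C' ∧ ∀ n : ℕ, 1 ≤ n → C * ρ ^ n ≤ C' * (n : ℝ) ^ (-β) := by
  obtain ⟨N, hN⟩ := exists_nat_ge β
  have hlim := tendsto_pow_const_mul_const_pow_of_lt_one N hρ0 hρ1
  obtain ⟨B, hB⟩ := hlim.bddAbove_range
  refine ⟨C * (|B| + 1), by positivity, fun n hn => ?_⟩
  have hn' : (1 : ℝ) ≤ n := by exact_mod_cast hn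
  have h1 : (n : ℝ) ^ N * ρ ^ n ≤ B := hB ⟨n, rfl⟩
  have h2 : (n : ℝ) ^ β ≤ (n : ℝ) ^ N := by
    rw [← Real.rpow_natCast]
    exact Real.rpow_le_rpow_of_exponent_le hn' hN
  have h3 : (n : ℝ) ^ β * ρ ^ n ≤ |B| + 1 := by
    have : (n : ℝ) ^ β * ρ ^ n ≤ (n : ℝ) ^ N * ρ ^ n := by gcongr
    linarith [le_abs_self B]
  rw [Real.rpow_neg (by linarith), ← div_eq_mul_inv, le_div_iff₀ (by positivity)]
  calc C * ρ ^ n * (n : ℝ) ^ β = C * ((n : ℝ) ^ β * ρ ^ n) := by ring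
    _ ≤ C * (|B| + 1) := by gcongr

end Main

theorem mainTheorem10 {Ω : Type*} [MeasurableSpace Ω] (μ : Measure Ω) [IsProbabilityMeasure μ]
    (X : ℕ → Ω → ℝ) (hX : ∀ j, Measurable (X j))
    (hstat : StrictlyStationary μ X) (hmix : IsAlphaMixing μ X)
    (hcont : ContinuousAtRightEnd (marginalDF μ X)) :
    ((∃ m : ℕ, alphaCoeff μ X (m + 1) = 0) → DeltaZero (marginalDF μ X) →
        AdmitsContinuousPhantomDF μ X) ∧
    ((∃ C ρ : ℝ, 0 < C ∧ 0 ≤ ρ ∧ ρ < 1 ∧ ∀ n : ℕ, 1 ≤ n → alphaCoeff μ X n ≤ C * ρ ^ n) →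
        (∃ ξ : ℝ, 0 < ξ ∧ DeltaXi (marginalDF μ X) ξ) →
        AdmitsContinuousPhantomDF μ X) ∧
    (∀ C β : ℝ, 0 < C → 0 < β →
        (∀ n : ℕ, 1 ≤ n → alphaCoeff μ X n ≤ C * (n : ℝ) ^ (-β)) →
        (∃ ξ : ℝ, 1 / β < ξ ∧ DeltaXi (marginalDF μ X) ξ) →
        AdmitsContinuousPhantomDF μ X) := by
  refine ⟨?_, ?_, ?_⟩
  · rintro ⟨m, hm⟩ hΔ
    exact admitsContinuousPhantomDF_of_mDependent hstat hX hmix hcont hm hΔ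
  · rintro ⟨C, ρ, hC, hρ0, hρ1, hα⟩ ⟨ξ, hξ, hΔ⟩
    -- Any `β > 1/ξ` would do; `2/ξ` gives `1/β = ξ/2 < ξ`.
    obtain ⟨C', hC', h⟩ := exists_geometric_le_rpow (β := 2 / ξ) hC hρ0 hρ1
    refine admitsContinuousPhantomDF_of_polynomial hstat hX hmix hcont hC'
      (show 0 < 2 / ξ by positivity) (fun n hn => (hα n hn).trans (h n hn)) ?_ hΔ
    rw [one_div_div]
    linarith
  · rintro C β hC hβ hα ⟨ξ, hξ, hΔ⟩
    exact admitsContinuousPhantomDF_of_polynomial hstat hX hmix hcont hC hβ hα hξ hΔ
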